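/- Let $n\ge 4$, let $\mathbb{Z}_n$ be the cyclic group of order $n$ and $\mu_n$ its normalized counting measure, write $\|f\|_2^2=\int_{\mathbb{Z}_n} f^2\,d\mu_n$ and $\langle f,g\rangle=\int_{\mathbb{Z}_n} fg\,d\mu_n$ for real functions on $\mathbb{Z}_n$, and let $K$ be the Markov kernel of the simple random walk on $\mathbb{Z}_n$, that is, $K(x,y)=\frac12$ if $y=x\pm1$ (modulo $n$) and $K(x,y)=0$ otherwise, acting on functions by $(Kf)(x)=\sum_{y}K(x,y)f(y)$. Then, with the convention $0\log 0=0$, every function $f:\mathbb{Z}_n\to[0,\infty)$ satisfies the logarithmic Sobolev inequality $$\int_{\mathbb{Z}_n} f^2\log f^2\,d\mu_n-\|f\|_2^2\log\|f\|_2^2\;\le\;\frac{2}{1-\cos\left(\frac{2\pi}{n}\right)}\,\langle f,(I-K)f\rangle .$$ Moreover, the constant $\frac{2}{1-\cos(2\pi/n)}$ is optimal: if $C$ is a real number such that the inequality holds for all $f:\mathbb{Z}_n\to[0,\infty)$ with $C$ in place of $\frac{2}{1-\cos(2\pi/n)}$, then $C\ge\frac{2}{1-\cos(2\pi/n)}$.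 -/

import Mathlib

open MeasureTheory

namespace CyclicWalk

/-- The normalized counting measure on the cyclic group of order `n`. -/
noncomputable def mu (n : ℕ) : Measure (ZMod n) :=
  ProbabilityTheory.uniformOn Set.univ

/-- The Markov kernel of the simple random walk on the cyclic group of order `n`:
from `x` the walk goes to `x + 1` or to `x - 1`, each with probability `1 / 2`
(the two neighbours are distinct as soon as `n` is at least `3`). -/
noncomputable def kernel (n : ℕ) : Matrix (ZMod n) (ZMod n) ℝ :=
  fun x y => if y = x + 1 ∨ y = x - 1 then 1 / 2 else 0

/-- The inner product of `L²(μₙ)` on real functions. -/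
noncomputable def innerL2 (n : ℕ) (f g : ZMod n → ℝ) : ℝ :=
  ∫ x, f x * g x ∂(mu n)

/-- The logarithmic Sobolev inequality with constant `C` for the simple random walk,
for all nonnegative functions. Every function on the finite group is square integrable, and
`Real.log 0 = 0` realizes the convention `0 log 0 = 0`. -/
def SatisfiesLSI (n : ℕ) [NeZero n] (C : ℝ) : Prop :=
  ∀ f : ZMod n → ℝ, (∀ x, 0 ≤ f x) →
    ∫ x, f x ^ 2 * Real.log (f x ^ 2) ∂(mu n)
        - lpNorm f 2 (mu n) ^ 2 * Real.log (lpNorm f 2 (mu n) ^ 2)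
      ≤ C * innerL2 n f ((1 - kernel n).mulVec f)

end CyclicWalk

namespace CyclicWalk

open Finset

/-! Write f = A + g with A the mean of f, and let u = ‖f‖₂, s = ‖g‖₂², κ the mean of g³, λ = 1 -
cos(2π/n) the spectral gap, and D = ⟨f,(I-K)f⟩/λ - s the defect in the Poincaré inequality. The
cubic Taylor majorant of x² log x² (`sq_mul_log_sq_le`), applied to f/u, bounds the entropy by an
expression in A, u, s and κ. This is at most 2(s + D) once κ² ≤ 9s²D (`moment_bound`).

That cubic estimate (`sum_cube_sq_le`) is the heart. In Fourier space κ is a sum over triples of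
nonzero frequencies with sum zero. Each triple has a longest member, so up to a factor 3 only pairs
no longer than their sum matter. Cauchy–Schwarz (`trilinear_sq_le`) then asks only that the number
of such pairs with sum k be at most 2(λ_k/λ - 1), where λ_k is the eigenvalue at k
(`dominatedCount_le_eigenvalue`).

For optimality, take f = 1 + εc with c a real eigenfunction for λ: as ε → 0 the entropy is 2ε²‖c‖₂²
to leading order, while the energy is λε²‖c‖₂². -/

/-- Distance of a residue to zero on the cycle. -/
def cycleLen {n : ℕ} (x : ZMod n) : ℕ := x.valMinAbs.natAbs

/-! ### Counting dominated pairs of frequencies -/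

section CycleLen

variable {n : ℕ}

lemma cycleLen_neg (x : ZMod n) : cycleLen (-x) = cycleLen x := ZMod.natAbs_valMinAbs_neg x

lemma cycleLen_eq_zero {x : ZMod n} : cycleLen x = 0 ↔ x = 0 := by
  simp [cycleLen]

lemma cycleLen_intCast_le [NeZero n] (m : ℤ) : cycleLen (m : ZMod n) ≤ m.natAbs := by
  apply ZMod.natAbs_min_of_le_div_two n
  · simp
  · exact ZMod.natAbs_valMinAbs_le _

/-- The pair `i, j` of nonzero residues is no longer than its sum. -/
def IsDominated (i j : ZMod n) : Prop :=
  i ≠ 0 ∧ j ≠ 0 ∧ cycleLen i ≤ cycleLen (i + j) ∧ cycleLen j ≤ cycleLen (i + j)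

noncomputable instance (i j : ZMod n) : Decidable (IsDominated i j) := Classical.dec _

/-- For the least representatives a, b, one of a + b and a - b has absolute value ||a| - |b||, which
is less than max(|a|, |b|) because neither is zero. -/
lemma IsDominated.not_neg_right [NeZero n] {i j : ZMod n} (h : IsDominated i j) :
    ¬ IsDominated i (-j) := by
  rintro ⟨-, -, h3, h4⟩
  obtain ⟨hi, hj, h1, h2⟩ := h
  rw [cycleLen_neg] at h4
  have e1 : i + j = ((i.valMinAbs + j.valMinAbs : ℤ) : ZMod n) := by simp
  have e2 : i + -j = ((i.valMinAbs - j.valMinAbs : ℤ) : ZMod n) := by simp [sub_eq_add_neg]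
  have a1 := cycleLen_intCast_le (n := n) (i.valMinAbs + j.valMinAbs)
  have a2 := cycleLen_intCast_le (n := n) (i.valMinAbs - j.valMinAbs)
  rw [← e1] at a1
  rw [← e2] at a2
  have hi' : i.valMinAbs ≠ 0 := by simpa using hi
  have hj' : j.valMinAbs ≠ 0 := by simpa using hj
  have d1 : cycleLen i = i.valMinAbs.natAbs := rfl
  have d2 : cycleLen j = j.valMinAbs.natAbs := rfl
  omega

/-- Discard a longest member of the zero-sum triple i, j, -(i + j); the other two form a dominated
pair. -/
lemma isDominated_or {i j : ZMod n} (hi : i ≠ 0) (hj : j ≠ 0) (hij : i + j ≠ 0) :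
    IsDominated i j ∨ IsDominated i (-(i + j)) ∨ IsDominated j (-(i + j)) := by
  have e1 : i + -(i + j) = -j := by ring
  have e2 : j + -(i + j) = -i := by ring
  simp only [IsDominated, e1, e2, cycleLen_neg]
  have : -(i + j) ≠ 0 := neg_ne_zero.mpr hij
  simp only [ne_eq, hi, hj, this, not_false_iff, true_and]
  omega

/-- The number of ways of writing `k` as the sum of a dominated pair. -/
noncomputable def dominatedCount [NeZero n] (k : ZMod n) : ℕ :=
  #{i : ZMod n | IsDominated i (k - i)}

lemma card_cycleLen_le [NeZero n] (L : ℕ) : #{i : ZMod n | cycleLen i ≤ L} ≤ 2 * L + 1 := by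
  have : ({i : ZMod n | cycleLen i ≤ L} : Finset (ZMod n)) ⊆
      (Finset.Icc (-L : ℤ) L).image (fun m : ℤ => (m : ZMod n)) := by
    intro i hi
    have hi' : i.valMinAbs.natAbs ≤ L := (mem_filter.mp hi).2
    simp only [mem_image, mem_Icc]
    exact ⟨i.valMinAbs, by omega, by simp⟩
  refine (card_le_card this).trans (card_image_le.trans ?_)
  simp
  omega

/-- The two lost units are i = 0 and i = k. `S` will be the ball of radius `cycleLen k`, or the
whole group, which is needed for n = 4. -/
lemma dominatedCount_add_two_le [NeZero n] {k : ZMod n} (hk : k ≠ 0) {m : ℕ}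
    (S : Finset (ZMod n)) (hS : ∀ i, cycleLen i ≤ cycleLen k → i ∈ S) (hm : #S ≤ m) :
    dominatedCount k + 2 ≤ m := by
  have h0 : (0 : ZMod n) ∈ S := hS _ (by simp [cycleLen])
  have h1 : k ∈ S := hS _ le_rfl
  have h2 : ({i : ZMod n | IsDominated i (k - i)} : Finset (ZMod n)) ⊆ (S.erase 0).erase k := by
    intro i hi
    simp only [mem_filter, mem_univ, true_and, IsDominated, add_sub_cancel] at hi
    simp only [mem_erase]
    exact ⟨fun h => hi.2.1 (by simp [h]), hi.1, hS _ hi.2.2.1⟩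
  have h3 := card_le_card h2
  rw [card_erase_of_mem (mem_erase.mpr ⟨hk, h1⟩), card_erase_of_mem h0] at h3
  have h4 : 2 ≤ #S := by
    rw [← card_pair (Ne.symm hk)]
    exact card_le_card (by intro x; simp; rintro (rfl | rfl) <;> assumption)
  unfold dominatedCount
  omega

lemma dominatedCount_le [NeZero n] {k : ZMod n} (hk : k ≠ 0) :
    dominatedCount k + 1 ≤ 2 * cycleLen k := by
  have := dominatedCount_add_two_le hk {i : ZMod n | cycleLen i ≤ cycleLen k} (by simp)
    (card_cycleLen_le (cycleLen k))
  omega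

lemma dominatedCount_le_card [NeZero n] {k : ZMod n} (hk : k ≠ 0) :
    dominatedCount k + 2 ≤ n :=
  dominatedCount_add_two_le hk univ (by simp) (by simp [ZMod.card])

/-- Both summands would be ±1, so ±1 would be congruent to an even number at distance at most 3,
impossible for n ≥ 4. For n = 3 it fails: 1 + 1 = -1. -/
lemma dominatedCount_of_cycleLen_eq_one [NeZero n] (hn : 4 ≤ n) {k : ZMod n}
    (hk : cycleLen k = 1) : dominatedCount k = 0 := by
  unfold dominatedCount
  rw [card_eq_zero, filter_eq_empty_iff]
  rintro i - ⟨h0, h1, h2, h3⟩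
  rw [add_sub_cancel, hk] at h2 h3
  have a1 : i.valMinAbs ≠ 0 := by simpa using h0
  have a2 : (k - i).valMinAbs ≠ 0 := by simpa using h1
  unfold cycleLen at hk h2 h3
  have b : k.valMinAbs - (i.valMinAbs + (k - i).valMinAbs) = 0 := by
    refine Int.eq_zero_of_abs_lt_dvd (m := n) ?_ ?_
    · rw [← ZMod.intCast_zmod_eq_zero_iff_dvd]
      simp
    · rw [abs_lt]
      constructor <;> omega
  omega

end CycleLen

/-! ### Trilinear estimate -/

/-- A Cauchy–Schwarz estimate for the trilinear convolution form of an even sequence. -/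
lemma trilinear_sq_le {n : ℕ} [NeZero n] (b w : ZMod n → ℝ) (hb : ∀ i, 0 ≤ b i) (hb0 : b 0 = 0)
    (hbn : ∀ i, b (-i) = b i) (hw : ∀ k, k ≠ 0 → (dominatedCount k : ℝ) ≤ 2 * w k) :
    (∑ i, ∑ j, b i * b j * b (i + j)) ^ 2 ≤ 9 * (∑ i, b i ^ 2) ^ 2 * ∑ k, w k * b k ^ 2 := by
  classical
  set θ : ZMod n → ZMod n → ℝ := fun i j => if IsDominated i j then 1 else 0 with hθ
  have hθ0 : ∀ i j, 0 ≤ θ i j := fun i j => by simp only [hθ]; split_ifs <;> norm_num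
  set X := ∑ i, ∑ j, θ i j * (b i * b j * b (i + j)) with hX
  -- The involution j ↦ -(i + j) permutes the triple and, b being even, preserves the product.
  have e1 : ∑ i, ∑ j, θ i (-(i + j)) * (b i * b j * b (i + j)) = X := by
    refine sum_congr rfl fun i _ => ?_
    refine Fintype.sum_equiv ((Equiv.addLeft i).trans (Equiv.neg _)) _ _ fun j => ?_
    have : i + -(i + j) = -j := by ring
    simp only [Equiv.trans_apply, Equiv.coe_addLeft, Equiv.neg_apply, this, hbn]
    ring
  have e2 : ∑ i, ∑ j, θ j (-(i + j)) * (b i * b j * b (i + j)) = X := by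
    rw [sum_comm, ← e1]
    refine sum_congr rfl fun i _ => sum_congr rfl fun j _ => ?_
    rw [add_comm j i]
    ring
  have hT : ∑ i, ∑ j, b i * b j * b (i + j) ≤ 3 * X := by
    have : 3 * X = ∑ i, ∑ j, (θ i j + θ i (-(i + j)) + θ j (-(i + j))) * (b i * b j * b (i + j)) := by
      simp only [add_mul, sum_add_distrib]
      rw [e1, e2]
      ring
    rw [this]
    refine sum_le_sum fun i _ => sum_le_sum fun j _ => ?_
    by_cases hi : i = 0
    · simp [hi, hb0]
    by_cases hj : j = 0
    · simp [hj, hb0]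
    by_cases hij : i + j = 0
    · simp [hij, hb0]
    have hp : 0 ≤ b i * b j * b (i + j) := mul_nonneg (mul_nonneg (hb _) (hb _)) (hb _)
    refine le_mul_of_one_le_left hp ?_
    have h1 := hθ0 i j
    have h2 := hθ0 i (-(i + j))
    have h3 := hθ0 j (-(i + j))
    rcases isDominated_or hi hj hij with h | h | h
    · have : θ i j = 1 := if_pos h
      linarith
    · have : θ i (-(i + j)) = 1 := if_pos h
      linarith
    · have : θ j (-(i + j)) = 1 := if_pos h
      linarith
  -- (i, j) and (i, -j) carry equal weight and at most one of them is dominated, which saves a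
  -- factor 2.
  have hP : 2 * ∑ i, ∑ j, (θ i j * (b i * b j)) ^ 2 ≤ (∑ i, b i ^ 2) ^ 2 := by
    have e3 : ∑ i, ∑ j, (θ i (-j) * (b i * b j)) ^ 2 = ∑ i, ∑ j, (θ i j * (b i * b j)) ^ 2 := by
      refine sum_congr rfl fun i _ => ?_
      refine Fintype.sum_equiv (Equiv.neg _) _ _ fun j => ?_
      simp [hbn]
    rw [two_mul]
    nth_rewrite 2 [← e3]
    rw [← sum_add_distrib, sq (∑ i, b i ^ 2), sum_mul_sum]
    refine sum_le_sum fun i _ => ?_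
    rw [← sum_add_distrib]
    refine sum_le_sum fun j _ => ?_
    have hnn : 0 ≤ b i ^ 2 * b j ^ 2 := by positivity
    simp only [hθ]
    by_cases h : IsDominated i j
    · rw [if_pos h, if_neg h.not_neg_right]
      nlinarith
    · rw [if_neg h]
      split_ifs <;> nlinarith
  have hQ : ∑ i, ∑ j, (θ i j * b (i + j)) ^ 2 ≤ 2 * ∑ k, w k * b k ^ 2 := by
    have e4 : ∑ i, ∑ j, (θ i j * b (i + j)) ^ 2 = ∑ k, (dominatedCount k : ℝ) * b k ^ 2 := by
      have : ∀ i, ∑ j, (θ i j * b (i + j)) ^ 2 = ∑ k, (θ i (k - i) * b k) ^ 2 := fun i =>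
        Fintype.sum_equiv (Equiv.addLeft i) _ _ fun j => by simp
      simp only [this]
      rw [sum_comm]
      refine sum_congr rfl fun k _ => ?_
      simp only [mul_pow, ← sum_mul, hθ, ite_pow, one_pow]
      simp [dominatedCount]
    rw [e4, mul_sum]
    refine sum_le_sum fun k _ => ?_
    by_cases hk : k = 0
    · simp [hk, hb0]
    · rw [← mul_assoc]
      exact mul_le_mul_of_nonneg_right (hw k hk) (sq_nonneg _)
  have hX2 : X ^ 2 ≤ (∑ i, ∑ j, (θ i j * (b i * b j)) ^ 2) * ∑ i, ∑ j, (θ i j * b (i + j)) ^ 2 := by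
    have := sum_mul_sq_le_sq_mul_sq (univ : Finset (ZMod n × ZMod n))
      (fun p => θ p.1 p.2 * (b p.1 * b p.2)) (fun p => θ p.1 p.2 * b (p.1 + p.2))
    simp only [Fintype.sum_prod_type] at this
    refine le_of_eq_of_le ?_ this
    rw [hX]
    congr 1
    refine sum_congr rfl fun i _ => sum_congr rfl fun j _ => ?_
    simp only [hθ]
    split_ifs <;> ring
  have hT0 : 0 ≤ ∑ i, ∑ j, b i * b j * b (i + j) :=
    sum_nonneg fun i _ => sum_nonneg fun j _ => mul_nonneg (mul_nonneg (hb _) (hb _)) (hb _)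
  have hP0 : 0 ≤ ∑ i, ∑ j, (θ i j * (b i * b j)) ^ 2 :=
    sum_nonneg fun i _ => sum_nonneg fun j _ => sq_nonneg _
  have hQ0 : 0 ≤ ∑ i, ∑ j, (θ i j * b (i + j)) ^ 2 :=
    sum_nonneg fun i _ => sum_nonneg fun j _ => sq_nonneg _
  calc (∑ i, ∑ j, b i * b j * b (i + j)) ^ 2 ≤ (3 * X) ^ 2 := pow_le_pow_left₀ hT0 hT 2
    _ = 9 * X ^ 2 := by ring
    _ ≤ 9 * ((∑ i, ∑ j, (θ i j * (b i * b j)) ^ 2) * ∑ i, ∑ j, (θ i j * b (i + j)) ^ 2) := by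
        gcongr
    _ ≤ 9 * (((∑ i, b i ^ 2) ^ 2 / 2) * (2 * ∑ k, w k * b k ^ 2)) := by
        gcongr
        linarith
    _ = _ := by ring

end CyclicWalk

/-! ### Eigenvalue growth and one-variable inequalities -/

namespace CyclicWalk

lemma one_sub_cos_two_mul (x : ℝ) : 1 - Real.cos (2 * x) = 2 * Real.sin x ^ 2 := by
  rw [Real.cos_two_mul, ← Real.sin_sq_add_cos_sq x]; ring

/-- Growth of the eigenvalues of the cycle of length `n ≥ 5`. -/
lemma eigenvalue_growth {n L : ℕ} (hn : 5 ≤ n) (hL : 2 ≤ L) (hLn : 2 * L ≤ n) :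
    (L + 1 / 2) * (1 - Real.cos (2 * (Real.pi / n))) ≤ 1 - Real.cos (2 * (L * (Real.pi / n))) := by
  have hn0 : (0 : ℝ) < n := by positivity
  have hn5 : (5 : ℝ) ≤ n := by exact_mod_cast hn
  set t := Real.pi / n with ht
  have ht0 : 0 < t := by positivity
  have hpi := Real.pi_pos
  have ht5 : t ≤ Real.pi / 5 := div_le_div_of_nonneg_left hpi.le (by norm_num) hn5
  have hs0 : 0 ≤ Real.sin t := Real.sin_nonneg_of_nonneg_of_le_pi ht0.le (by linarith)
  have hst : Real.sin t ≤ t := Real.sin_le ht0.le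
  rw [one_sub_cos_two_mul, one_sub_cos_two_mul]
  rcases hL.eq_or_lt with rfl | hL3
  -- For L = 2 the claim is cos² t ≥ 5/8; at t = π/5 this amounts to √5 ≥ 2, and it fails at t =
  -- π/4.
  · have hc : Real.cos (Real.pi / 5) ≤ Real.cos t :=
      Real.cos_le_cos_of_nonneg_of_le_pi ht0.le (by linarith) ht5
    rw [Real.cos_pi_div_five] at hc
    have h5 : (2 : ℝ) ≤ √5 := Real.le_sqrt_of_sq_le (by norm_num)
    have h55 : √5 ^ 2 = 5 := Real.sq_sqrt (by norm_num)
    have hc2 : 5 / 8 ≤ Real.cos t ^ 2 := by nlinarith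
    push_cast
    rw [Real.sin_two_mul]
    nlinarith [sq_nonneg (Real.sin t)]
  · have hL3' : (3 : ℝ) ≤ L := by exact_mod_cast hL3
    have hLt : L * t ≤ Real.pi / 2 := by
      rw [ht, mul_div_assoc', div_le_div_iff₀ hn0 (by norm_num)]
      have : (2 * L : ℝ) ≤ n := by exact_mod_cast hLn
      nlinarith
    -- Jordan's inequality suffices from L = 3 on: 4L²/π² ≥ 4L²/10 ≥ L + 1/2, barely at L = 3.
    have hJ := Real.mul_le_sin (x := L * t) (by positivity) hLt
    have hJ2 : (2 / Real.pi * (L * t)) ^ 2 ≤ Real.sin (L * t) ^ 2 :=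
      pow_le_pow_left₀ (by positivity) hJ 2
    have hst2 : Real.sin t ^ 2 ≤ t ^ 2 := pow_le_pow_left₀ hs0 hst 2
    have hpi2 : Real.pi ^ 2 ≤ 10 := by
      have := Real.pi_lt_d2
      nlinarith
    have hcoef : (L : ℝ) + 1 / 2 ≤ (2 / Real.pi * L) ^ 2 := by
      rw [mul_pow, div_pow, div_mul_eq_mul_div, le_div_iff₀ (by positivity)]
      nlinarith
    have : (2 / Real.pi * (L * t)) ^ 2 = (2 / Real.pi * L) ^ 2 * t ^ 2 := by ring
    have h4 : ((L : ℝ) + 1 / 2) * Real.sin t ^ 2 ≤ (2 / Real.pi * L) ^ 2 * t ^ 2 :=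
      mul_le_mul hcoef hst2 (sq_nonneg _) (sq_nonneg _)
    linarith

/-- The order-three Taylor bound for `x ^ 2 * log (x ^ 2)` at `1`. -/
lemma sq_mul_log_sq_le {x : ℝ} (hx : 0 ≤ x) :
    x ^ 2 * Real.log (x ^ 2) ≤ 2 / 3 * x ^ 3 + x ^ 2 - 2 * x + 1 / 3 := by
  rcases hx.eq_or_lt with rfl | hx
  · norm_num
  -- ψ is the difference of the two sides divided by x²; this makes its derivative rational, with
  -- the sign of (y - 1)³, so its minimum is ψ(1) = 0.
  set ψ : ℝ → ℝ := fun y => 2 / 3 * y + 1 - 2 * y⁻¹ + 1 / 3 * (y⁻¹) ^ 2 - 2 * Real.log y with hψ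
  have hd : ∀ y : ℝ, 0 < y → HasDerivAt ψ (2 / 3 * (y⁻¹) ^ 3 * (y - 1) ^ 3) y := by
    intro y hy
    have h := (((((hasDerivAt_id y).const_mul (2 / 3 : ℝ)).add_const 1).sub
      ((hasDerivAt_inv hy.ne').const_mul 2)).add
      (((hasDerivAt_inv hy.ne').pow 2).const_mul (1 / 3 : ℝ))).sub
      ((Real.hasDerivAt_log hy.ne').const_mul 2)
    refine (h.congr_deriv ?_ : HasDerivAt ψ _ y)
    simp only [Nat.cast_ofNat, Nat.reduceSub, pow_one]
    field_simp
    ring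
  have hcont : ContinuousOn ψ (Set.Ioi 0) := fun y hy => (hd y hy).continuousAt.continuousWithinAt
  have hpos : 0 ≤ ψ x := by
    have h1 : ψ 1 = 0 := by simp [hψ]; norm_num
    rw [← h1]
    rcases le_total 1 x with h | h
    · have : MonotoneOn ψ (Set.Ici 1) := by
        refine monotoneOn_of_deriv_nonneg (convex_Ici 1)
          (hcont.mono fun y hy => Set.mem_Ioi.mpr (one_pos.trans_le hy)) ?_ ?_
        · intro y hy
          rw [interior_Ici] at hy
          exact (hd y (one_pos.trans hy)).differentiableAt.differentiableWithinAt
        · intro y hy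
          rw [interior_Ici] at hy
          have hy' : (1 : ℝ) < y := hy
          rw [(hd y (one_pos.trans hy)).deriv]
          have : 0 < y - 1 := by linarith
          positivity
      exact this (Set.mem_Ici.mpr le_rfl) h h
    · have : AntitoneOn ψ (Set.Ioc 0 1) := by
        refine antitoneOn_of_deriv_nonpos (convex_Ioc 0 1) (hcont.mono fun y hy => hy.1) ?_ ?_
        · intro y hy
          rw [interior_Ioc] at hy
          exact (hd y hy.1).differentiableAt.differentiableWithinAt
        · intro y hy
          rw [interior_Ioc] at hy
          have hy0 := hy.1
          rw [(hd y hy.1).deriv]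
          refine mul_nonpos_of_nonneg_of_nonpos (by positivity) ?_
          have : 0 ≤ (1 - y) ^ 3 := pow_nonneg (by linarith [hy.2]) 3
          nlinarith
      exact this ⟨hx, h⟩ ⟨one_pos, le_rfl⟩ h
  have h2 : x ^ 2 * ψ x = 2 / 3 * x ^ 3 + x ^ 2 - 2 * x + 1 / 3 - x ^ 2 * Real.log (x ^ 2) := by
    rw [Real.log_pow]
    simp only [hψ]
    push_cast
    field_simp
  nlinarith [mul_nonneg (sq_nonneg x) hpos]

/-- A quadratic lower bound with cubic error for `(1 + y) ^ 2 * log ((1 + y) ^ 2)`. -/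
lemma le_sq_mul_log_sq {y : ℝ} (hy : |y| ≤ 1 / 2) :
    2 * y + 3 * y ^ 2 - 20 * |y| ^ 3 ≤ (1 + y) ^ 2 * Real.log ((1 + y) ^ 2) := by
  have h := Real.abs_log_sub_add_sum_range_le (x := -y) (by rw [abs_neg]; linarith) 2
  simp only [Finset.sum_range_succ, Finset.sum_range_zero, abs_neg, sub_neg_eq_add] at h
  norm_num at h
  have h1 : |y| ^ 3 / (1 - |y|) ≤ 2 * |y| ^ 3 := by
    rw [div_le_iff₀ (by linarith)]
    have : 0 ≤ |y| ^ 3 := by positivity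
    nlinarith
  have h2 := (abs_le.mp (h.trans h1)).1
  have ha := abs_le.mp hy
  have h3 : 0 ≤ |y| := abs_nonneg y
  have h4 : |y| ^ 3 = |y| * y ^ 2 := by rw [pow_succ, sq_abs]; ring
  have h5 : (1 + y) ^ 2 ≤ 9 / 4 := by nlinarith
  have h6 : (1 + y) ^ 2 * (y - y ^ 2 / 2 - 2 * |y| ^ 3) ≤ (1 + y) ^ 2 * Real.log (1 + y) :=
    mul_le_mul_of_nonneg_left (by linarith) (sq_nonneg _)
  -- In (1 + y)²(2y - y²) the cubic terms cancel, leaving -y⁴; the total error is below 10|y|³, so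
  -- 20 is generous.
  have h7 : (1 + y) ^ 2 * |y| ^ 3 ≤ 9 / 4 * |y| ^ 3 := by gcongr
  have h8 : y ^ 4 ≤ 1 / 2 * |y| ^ 3 := by
    have : y ^ 4 = |y| * |y| ^ 3 := by
      rw [← pow_succ']; exact (Even.pow_abs (by decide) y).symm
    rw [this]; gcongr
  have h9 : 0 ≤ |y| ^ 3 := by positivity
  rw [Real.log_pow]
  push_cast
  nlinarith

lemma mul_log_one_add_le {s : ℝ} (hs : 0 ≤ s) : (1 + s) * Real.log (1 + s) ≤ s + s ^ 2 := by
  have := Real.log_le_sub_one_of_pos (x := 1 + s) (by linarith)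
  nlinarith

end CyclicWalk

namespace CyclicWalk

open Finset ComplexConjugate

lemma one_sub_cos_pos {n : ℕ} (hn : 4 ≤ n) : 0 < 1 - Real.cos (2 * Real.pi / n) := by
  have hn' : (4 : ℝ) ≤ n := by exact_mod_cast hn
  have h0 : 0 < 2 * Real.pi / n := by positivity
  have h1 : 2 * Real.pi / n ≤ Real.pi := by
    rw [div_le_iff₀ (by linarith)]
    nlinarith [Real.pi_pos]
  have := Real.cos_lt_cos_of_nonneg_of_le_pi le_rfl h1 h0
  rw [Real.cos_zero] at this
  linarith

/-! ### Fourier analysis and the third moment -/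

section Fourier

variable {n : ℕ} [NeZero n]

lemma sum_stdAddChar_mul (t : ZMod n) :
    ∑ x, ZMod.stdAddChar (t * x) = if t = 0 then (n : ℂ) else 0 := by
  split_ifs with h
  · simp [h, ZMod.card]
  · exact AddChar.sum_eq_zero_of_ne_one (ZMod.isPrimitive_stdAddChar n h)

lemma conj_stdAddChar (x : ZMod n) :
    conj (ZMod.stdAddChar x) = ZMod.stdAddChar (-x) := by
  rw [AddChar.map_neg_eq_inv, ZMod.stdAddChar_apply, ← Circle.coe_inv, Circle.coe_inv_eq_conj]

/-- Cosine is even, so the eigenvalue 1 - Re χ(k) of I - K depends only on the length of k. -/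
lemma re_stdAddChar (k : ZMod n) :
    (ZMod.stdAddChar k).re = Real.cos (2 * (cycleLen k * (Real.pi / n))) := by
  have h : (ZMod.stdAddChar k : ℂ) =
      Complex.exp ((2 * (k.valMinAbs * (Real.pi / n)) : ℝ) * Complex.I) := by
    conv_lhs => rw [← ZMod.coe_valMinAbs k]
    rw [ZMod.stdAddChar_coe]
    congr 1
    push_cast
    ring
  rw [h, Complex.exp_ofReal_mul_I_re, cycleLen, Nat.cast_natAbs]
  rcases abs_choice k.valMinAbs with h | h <;> rw [h]
  push_cast
  rw [← Real.cos_neg]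
  congr 1
  ring

lemma normSq_stdAddChar_sub_one (k : ZMod n) :
    ‖(ZMod.stdAddChar k : ℂ) - 1‖ ^ 2 = 2 * (1 - (ZMod.stdAddChar k).re) := by
  have h : (ZMod.stdAddChar k).re * (ZMod.stdAddChar k).re
      + (ZMod.stdAddChar k).im * (ZMod.stdAddChar k).im = 1 := by
    rw [← Complex.normSq_apply, ZMod.stdAddChar_apply, Circle.normSq_coe]
  rw [← Complex.normSq_eq_norm_sq, Complex.normSq_apply]
  simp only [Complex.sub_re, Complex.sub_im, Complex.one_re, Complex.one_im]
  linarith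

/-- `c` is the sequence of Fourier coefficients of `F`. -/
def HasFourierCoeff (F : ZMod n → ℝ) (c : ZMod n → ℂ) : Prop :=
  ∀ x, (F x : ℂ) = ∑ k, c k * ZMod.stdAddChar (k * x)

lemma HasFourierCoeff.sum_sq {F : ZMod n → ℝ} {c : ZMod n → ℂ} (h : HasFourierCoeff F c) :
    ∑ x, F x ^ 2 = n * ∑ k, ‖c k‖ ^ 2 := by
  have e : ∀ x, ((F x ^ 2 : ℝ) : ℂ) =
      ∑ i, ∑ j, c i * conj (c j) * ZMod.stdAddChar ((i - j) * x) := by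
    intro x
    have h2 : (F x : ℂ) = ∑ k, conj (c k) * ZMod.stdAddChar (-(k * x)) := by
      rw [← Complex.conj_ofReal, h x, map_sum]
      simp [conj_stdAddChar]
    push_cast
    rw [sq]
    nth_rewrite 1 [h x]
    rw [h2, sum_mul_sum]
    refine sum_congr rfl fun i _ => sum_congr rfl fun j _ => ?_
    rw [sub_mul, sub_eq_add_neg, AddChar.map_add_eq_mul]
    ring
  have : ((∑ x, F x ^ 2 : ℝ) : ℂ) = ((n * ∑ k, ‖c k‖ ^ 2 : ℝ) : ℂ) := by
    rw [Complex.ofReal_sum, sum_congr rfl fun x _ => e x, sum_comm]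
    push_cast
    rw [mul_sum]
    refine sum_congr rfl fun i _ => ?_
    rw [sum_comm]
    simp only [← mul_sum, sum_stdAddChar_mul, sub_eq_zero]
    simp [Complex.mul_conj, Complex.normSq_eq_norm_sq]
    ring
  exact_mod_cast this

/-- Orthogonality of characters keeps only the frequency triples with sum zero. -/
lemma HasFourierCoeff.sum_cube {F : ZMod n → ℝ} {c : ZMod n → ℂ} (h : HasFourierCoeff F c) :
    ((∑ x, F x ^ 3 : ℝ) : ℂ) = n * ∑ i, ∑ j, c i * c j * c (-(i + j)) := by
  have e : ∀ x, ((F x ^ 3 : ℝ) : ℂ) =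
      ∑ i, ∑ j, ∑ k, c i * c j * c k * ZMod.stdAddChar ((k - -(i + j)) * x) := by
    intro x
    push_cast
    rw [pow_succ, sq, h x, sum_mul_sum, sum_mul]
    refine sum_congr rfl fun i _ => ?_
    rw [sum_mul_sum]
    refine sum_congr rfl fun j _ => sum_congr rfl fun k _ => ?_
    have : (k - -(i + j)) * x = i * x + j * x + k * x := by ring
    rw [this, AddChar.map_add_eq_mul, AddChar.map_add_eq_mul]
    ring
  rw [Complex.ofReal_sum, sum_congr rfl fun x _ => e x, sum_comm, mul_sum]
  refine sum_congr rfl fun i _ => ?_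
  rw [sum_comm, mul_sum]
  refine sum_congr rfl fun j _ => ?_
  rw [sum_comm]
  simp only [← mul_sum, sum_stdAddChar_mul, sub_eq_zero]
  simp
  ring

lemma HasFourierCoeff.sub_shift {F : ZMod n → ℝ} {c : ZMod n → ℂ} (h : HasFourierCoeff F c) :
    HasFourierCoeff (fun x => F (x + 1) - F x) fun k => c k * (ZMod.stdAddChar k - 1) := by
  intro x
  push_cast
  rw [h (x + 1), h x, ← sum_sub_distrib]
  refine sum_congr rfl fun k _ => ?_
  rw [mul_add, mul_one, AddChar.map_add_eq_mul]
  ring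

lemma exists_hasFourierCoeff (F : ZMod n → ℝ) :
    ∃ c : ZMod n → ℂ, HasFourierCoeff F c ∧ c 0 = (n : ℂ)⁻¹ * ∑ x, (F x : ℂ) ∧
      ∀ k, c (-k) = conj (c k) := by
  refine ⟨fun k => (n : ℂ)⁻¹ * ZMod.dft (fun x => (F x : ℂ)) k, fun x => ?_, ?_, fun k => ?_⟩
  · have := congr_fun (ZMod.dft.symm_apply_apply (fun x => (F x : ℂ))) x
    rw [ZMod.invDFT_apply, smul_eq_mul, mul_sum] at this
    rw [← this]
    refine sum_congr rfl fun k _ => ?_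
    rw [smul_eq_mul]
    ring
  · simp only [ZMod.dft_apply_zero]
  · simp only [ZMod.dft_apply, map_mul, map_sum, smul_eq_mul, conj_stdAddChar, map_inv₀,
      Complex.conj_natCast, Complex.conj_ofReal, neg_neg, mul_neg]

lemma dominatedCount_le_eigenvalue (hn : 4 ≤ n) {k : ZMod n} (hk : k ≠ 0) :
    (dominatedCount k : ℝ) ≤
      2 * ((1 - (ZMod.stdAddChar k).re) / (1 - Real.cos (2 * Real.pi / n)) - 1) := by
  have hpos := one_sub_cos_pos hn
  have hL0 : cycleLen k ≠ 0 := fun h => hk (cycleLen_eq_zero.mp h)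
  have hL2 : 2 * cycleLen k ≤ n := by
    have := ZMod.natAbs_valMinAbs_le k
    unfold cycleLen
    omega
  rw [re_stdAddChar]
  rcases (show 1 ≤ cycleLen k by omega).eq_or_lt with h1 | h1
  · rw [dominatedCount_of_cycleLen_eq_one hn h1.symm, ← h1]
    have : (2 : ℝ) * ((1 : ℕ) * (Real.pi / n)) = 2 * Real.pi / n := by push_cast; ring
    rw [this, div_self hpos.ne']
    simp
  rcases hn.eq_or_lt with rfl | hn5
  -- For n = 4 and k = 2 the right-hand side is exactly 2, so the ball bound 3 is too weak and the
  -- bound n - 2 is used.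
  · have hL : cycleLen k = 2 := by omega
    have hc := dominatedCount_le_card hk
    have e1 : (2 : ℝ) * ((2 : ℕ) * (Real.pi / (4 : ℕ))) = Real.pi := by push_cast; ring
    have e2 : (2 : ℝ) * Real.pi / (4 : ℕ) = Real.pi / 2 := by push_cast; ring
    rw [hL, e1, e2, Real.cos_pi, Real.cos_pi_div_two]
    have : (dominatedCount k : ℝ) ≤ 2 := by exact_mod_cast (by omega : dominatedCount k ≤ 2)
    linarith
  · have hg := eigenvalue_growth hn5 h1 hL2
    have e : (2 : ℝ) * (Real.pi / n) = 2 * Real.pi / n := by ring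
    rw [e, ← le_div_iff₀ hpos] at hg
    have hc : (dominatedCount k : ℝ) + 1 ≤ 2 * cycleLen k := by
      exact_mod_cast dominatedCount_le hk
    linarith

/-- The third moment of a mean-zero function is controlled by its variance and its spectral
defect. -/
lemma sum_cube_sq_le (hn : 4 ≤ n) (g : ZMod n → ℝ) (hg : ∑ x, g x = 0) :
    ((∑ x, g x ^ 3) / n) ^ 2 ≤ 9 * ((∑ x, g x ^ 2) / n) ^ 2 *
      ((∑ x, (g (x + 1) - g x) ^ 2) / (2 * n) / (1 - Real.cos (2 * Real.pi / n))
        - (∑ x, g x ^ 2) / n) := by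
  obtain ⟨c, hc, hc0, hcn⟩ := exists_hasFourierCoeff g
  have hn0 : (n : ℝ) ≠ 0 := NeZero.ne _
  have h0 : c 0 = 0 := by
    rw [hc0, ← Complex.ofReal_sum, hg]
    simp
  have key := trilinear_sq_le (fun k => ‖c k‖)
    (fun k => (1 - (ZMod.stdAddChar k).re) / (1 - Real.cos (2 * Real.pi / n)) - 1)
    (fun _ => norm_nonneg _) (by simp [h0]) (fun k => by simp [hcn])
    (fun k hk => dominatedCount_le_eigenvalue hn hk)
  have h2 : (∑ x, g x ^ 2) / n = ∑ k, ‖c k‖ ^ 2 := by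
    rw [hc.sum_sq, mul_div_cancel_left₀ _ hn0]
  have h3 : (∑ x, (g (x + 1) - g x) ^ 2) / (2 * n) / (1 - Real.cos (2 * Real.pi / n))
        - (∑ x, g x ^ 2) / n = ∑ k, ((1 - (ZMod.stdAddChar k).re) /
          (1 - Real.cos (2 * Real.pi / n)) - 1) * ‖c k‖ ^ 2 := by
    rw [h2, hc.sub_shift.sum_sq]
    simp only [norm_mul, mul_pow, normSq_stdAddChar_sub_one, sub_mul, sum_sub_distrib, one_mul]
    congr 1
    rw [mul_comm (2 : ℝ), mul_div_mul_left _ _ hn0, sum_div, sum_div]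
    refine sum_congr rfl fun k _ => ?_
    ring
  rw [h3, h2]
  refine le_trans ?_ key
  rw [← sq_abs]
  refine pow_le_pow_left₀ (abs_nonneg _) ?_ 2
  have h4 : (((∑ x, g x ^ 3) / n : ℝ) : ℂ) = ∑ i, ∑ j, c i * c j * c (-(i + j)) := by
    rw [Complex.ofReal_div, hc.sum_cube, Complex.ofReal_natCast,
      mul_div_cancel_left₀ _ (NeZero.ne (n : ℂ))]
  rw [← Real.norm_eq_abs, ← Complex.norm_real, h4]
  refine (norm_sum_le _ _).trans (sum_le_sum fun i _ => (norm_sum_le _ _).trans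
    (sum_le_sum fun j _ => ?_))
  rw [norm_mul, norm_mul, hcn, RCLike.norm_conj]

end Fourier

end CyclicWalk

namespace CyclicWalk

open Finset

lemma cycleLen_one {n : ℕ} (hn : 2 ≤ n) : cycleLen (1 : ZMod n) = 1 := by
  have h := ZMod.valMinAbs_natCast_of_le_half (n := n) (a := 1) (by omega)
  rw [Nat.cast_one] at h
  rw [cycleLen, h]
  rfl

/-! ### Finite-sum form, moments and the inequality -/

section Functionals

variable {n : ℕ} [NeZero n]

lemma integral_mu (F : ZMod n → ℝ) : ∫ x, F x ∂(mu n) = (∑ x, F x) / n := by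
  have h : IsProbabilityMeasure (mu n) :=
    ProbabilityTheory.isProbabilityMeasure_uniformOn Set.finite_univ Set.univ_nonempty
  rw [integral_fintype .of_finite, sum_div]
  refine sum_congr rfl fun x _ => ?_
  rw [mu, measureReal_def, ProbabilityTheory.uniformOn_univ]
  simp [ZMod.card]
  ring

lemma lpNorm_two_sq (F : ZMod n → ℝ) : lpNorm F 2 (mu n) ^ 2 = (∑ x, F x ^ 2) / n := by
  rw [lpNorm_eq_integral_norm_rpow_toReal (by norm_num) (by norm_num)
    (measurable_of_finite F).aestronglyMeasurable, integral_mu, ← Real.rpow_natCast,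
    ← Real.rpow_mul (by positivity)]
  simp

lemma sum_shift (F : ZMod n → ℝ) : ∑ x, F (x + 1) = ∑ x, F x :=
  Fintype.sum_equiv (Equiv.addRight (1 : ZMod n)) _ _ fun _ => rfl

lemma kernel_mulVec (hn : 3 ≤ n) (F : ZMod n → ℝ) (x : ZMod n) :
    (kernel n).mulVec F x = (F (x + 1) + F (x - 1)) / 2 := by
  have hne : x + 1 ≠ x - 1 := by
    intro h
    have h2 : ((2 : ℕ) : ZMod n) = 0 := by
      push_cast
      linear_combination h
    rw [ZMod.natCast_eq_zero_iff] at h2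
    have := Nat.le_of_dvd two_pos h2
    omega
  have e : ∀ y, kernel n x y * F y =
      (if y = x + 1 then F y / 2 else 0) + if y = x - 1 then F y / 2 else 0 := by
    intro y
    simp only [kernel]
    by_cases h1 : y = x + 1
    · simp [h1, hne]
      ring
    · by_cases h2 : y = x - 1
      · simp [h2, hne.symm]
        ring
      · simp [h1, h2]
  simp only [Matrix.mulVec, dotProduct, e, sum_add_distrib, sum_ite_eq', mem_univ, if_true]
  ring

lemma innerL2_one_sub_kernel (hn : 3 ≤ n) (F : ZMod n → ℝ) :
    innerL2 n F ((1 - kernel n).mulVec F) = (∑ x, (F (x + 1) - F x) ^ 2) / (2 * n) := by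
  rw [innerL2, integral_mu]
  have e1 : ∑ x, F x * (1 - kernel n).mulVec F x
      = ∑ x, F x ^ 2 - (∑ x, F x * F (x + 1) + ∑ x, F x * F (x - 1)) / 2 := by
    rw [← sum_add_distrib, sum_div, ← sum_sub_distrib]
    refine sum_congr rfl fun x _ => ?_
    rw [Matrix.sub_mulVec, Matrix.one_mulVec, Pi.sub_apply, kernel_mulVec hn]
    ring
  have e2 : ∑ x, F x * F (x - 1) = ∑ x, F x * F (x + 1) := by
    rw [← sum_shift fun x => F x * F (x - 1)]
    refine sum_congr rfl fun x _ => ?_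
    rw [add_sub_cancel_right, mul_comm]
  have e3 : ∑ x, (F (x + 1) - F x) ^ 2 = 2 * (∑ x, F x ^ 2 - ∑ x, F x * F (x + 1)) := by
    have h := sum_shift fun x => F x ^ 2
    have : ∑ x, (F (x + 1) - F x) ^ 2
        = ∑ x, F (x + 1) ^ 2 + ∑ x, F x ^ 2 - 2 * ∑ x, F x * F (x + 1) := by
      rw [mul_sum, ← sum_add_distrib, ← sum_sub_distrib]
      exact sum_congr rfl fun x _ => by ring
    rw [this, h]
    ring
  rw [e1, e2, e3, mul_div_mul_left _ _ two_ne_zero]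
  ring

/-- The logarithmic Sobolev inequality written with finite sums. -/
lemma satisfiesLSI_iff (hn : 3 ≤ n) (C : ℝ) :
    SatisfiesLSI n C ↔ ∀ f : ZMod n → ℝ, (∀ x, 0 ≤ f x) →
      (∑ x, f x ^ 2 * Real.log (f x ^ 2)) / n
        - (∑ x, f x ^ 2) / n * Real.log ((∑ x, f x ^ 2) / n)
        ≤ C * ((∑ x, (f (x + 1) - f x) ^ 2) / (2 * n)) := by
  simp only [SatisfiesLSI, integral_mu, lpNorm_two_sq, innerL2_one_sub_kernel hn]

lemma mean_add_const (g : ZMod n → ℝ) (hg : ∑ x, g x = 0) (A : ℝ) :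
    (∑ x, (A + g x) ^ 2) / n = A ^ 2 + (∑ x, g x ^ 2) / n ∧
    (∑ x, (A + g x) ^ 3) / n = A ^ 3 + 3 * A * ((∑ x, g x ^ 2) / n) + (∑ x, g x ^ 3) / n := by
  have hn0 : (n : ℝ) ≠ 0 := NeZero.ne _
  have h2 : ∑ x, (A + g x) ^ 2 = n * A ^ 2 + 2 * A * ∑ x, g x + ∑ x, g x ^ 2 := by
    have : (n : ℝ) * A ^ 2 = ∑ _x : ZMod n, A ^ 2 := by simp [ZMod.card]
    rw [this, mul_sum, ← sum_add_distrib, ← sum_add_distrib]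
    exact sum_congr rfl fun x _ => by ring
  have h3 : ∑ x, (A + g x) ^ 3
      = n * A ^ 3 + 3 * A ^ 2 * ∑ x, g x + 3 * A * ∑ x, g x ^ 2 + ∑ x, g x ^ 3 := by
    have : (n : ℝ) * A ^ 3 = ∑ _x : ZMod n, A ^ 3 := by simp [ZMod.card]
    rw [this, mul_sum, mul_sum, ← sum_add_distrib, ← sum_add_distrib, ← sum_add_distrib]
    exact sum_congr rfl fun x _ => by ring
  rw [h2, h3, hg]
  constructor <;> field_simp <;> ring

/-- An upper bound for the entropy of `f ^ 2` in terms of the first three moments of `f`. -/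
lemma entropy_le_moments (f : ZMod n → ℝ) (hf : ∀ x, 0 ≤ f x) {u : ℝ} (hu : 0 < u)
    (hu2 : (∑ x, f x ^ 2) / n = u ^ 2) :
    (∑ x, f x ^ 2 * Real.log (f x ^ 2)) / n
        - (∑ x, f x ^ 2) / n * Real.log ((∑ x, f x ^ 2) / n)
      ≤ 2 / 3 * ((∑ x, f x ^ 3) / n) / u + 4 / 3 * u ^ 2 - 2 * ((∑ x, f x) / n) * u := by
  have hn0 : (0 : ℝ) < n := Nat.cast_pos.mpr (NeZero.pos n)
  have hp : ∀ x, f x ^ 2 * Real.log (f x ^ 2) ≤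
      f x ^ 2 * Real.log (u ^ 2) + (2 / 3 / u * f x ^ 3 + f x ^ 2 - 2 * u * f x + u ^ 2 / 3) := by
    intro x
    have h := sq_mul_log_sq_le (div_nonneg (hf x) hu.le)
    have h' := mul_le_mul_of_nonneg_left h (sq_nonneg u)
    rcases (hf x).eq_or_lt with h0 | h0
    -- The logarithm of the quotient does not split when f x = 0, but there the claim is just 0 ≤
    -- u²/3.
    · rw [← h0]
      simp only [ne_eq, OfNat.ofNat_ne_zero, not_false_eq_true, zero_pow, zero_mul, mul_zero]
      positivity
    · have e1 : Real.log ((f x / u) ^ 2) = Real.log (f x ^ 2) - Real.log (u ^ 2) := by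
        rw [div_pow, Real.log_div (by positivity) (by positivity)]
      have e2 : u ^ 2 * ((f x / u) ^ 2 * Real.log ((f x / u) ^ 2))
          = f x ^ 2 * Real.log (f x ^ 2) - f x ^ 2 * Real.log (u ^ 2) := by
        rw [e1]
        field_simp
      have e3 : u ^ 2 * (2 / 3 * (f x / u) ^ 3 + (f x / u) ^ 2 - 2 * (f x / u) + 1 / 3)
          = 2 / 3 / u * f x ^ 3 + f x ^ 2 - 2 * u * f x + u ^ 2 / 3 := by
        field_simp
      rw [e2, e3] at h'
      linarith
  have hs := sum_le_sum fun x (_ : x ∈ (univ : Finset (ZMod n))) => hp x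
  simp only [sum_add_distrib, sum_sub_distrib, ← mul_sum, ← sum_mul] at hs
  rw [sum_const, card_univ, ZMod.card, nsmul_eq_mul] at hs
  have hd := div_le_div_of_nonneg_right hs hn0.le
  have e : ((∑ x, f x ^ 2) * Real.log (u ^ 2) + (2 / 3 / u * ∑ x, f x ^ 3 + ∑ x, f x ^ 2
      - 2 * u * ∑ x, f x + n * (u ^ 2 / 3))) / n
      = (∑ x, f x ^ 2) / n * Real.log (u ^ 2) + (2 / 3 * ((∑ x, f x ^ 3) / n) / u
        + (∑ x, f x ^ 2) / n - 2 * ((∑ x, f x) / n) * u + u ^ 2 / 3) := by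
    field_simp
  rw [e] at hd
  rw [hu2] at hd ⊢
  linarith

lemma moment_bound {A u s κ D : ℝ} (hA : 0 ≤ A) (hu : 0 < u) (hs : 0 ≤ s) (hsD : 0 ≤ s + D)
    (hus : u ^ 2 = A ^ 2 + s) (hκ : κ ^ 2 ≤ 9 * s ^ 2 * D) :
    2 / 3 * (A ^ 3 + 3 * A * s + κ) / u + 4 / 3 * u ^ 2 - 2 * A * u ≤ 2 * (s + D) := by
  have hAu : A ≤ u := by nlinarith
  -- AM-GM for s/u and κ/s, with weights chosen so that the κ-part costs exactly 2D.
  have hκ2 : 2 / 3 * κ / u ≤ s ^ 2 / (2 * u ^ 2) + 2 * D := by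
    rcases hs.eq_or_lt with h0 | h0
    · subst h0
      have hk : κ = 0 := by nlinarith
      simp only [hk, mul_zero, zero_div]
      norm_num
      linarith
    · have hD : (κ / s) ^ 2 / 9 ≤ D := by
        rw [div_pow, div_div, div_le_iff₀ (by positivity)]
        linarith
      have e1 : 2 / 3 * κ / u = 2 / 3 * (s / u) * (κ / s) := by field_simp
      have e2 : s ^ 2 / (2 * u ^ 2) = (s / u) ^ 2 / 2 := by field_simp
      rw [e1, e2]
      nlinarith [sq_nonneg (s / u - 2 / 3 * (κ / s))]
  -- The κ-free terms leave enough slack below 2s to absorb s²/(2u²), with a remainder that is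
  -- nonnegative since A ≤ u.
  have hmain : 2 * s - (2 / 3 * (A ^ 3 + 3 * A * s) / u + 4 / 3 * u ^ 2 - 2 * A * u
      + s ^ 2 / (2 * u ^ 2)) = (u - A) ^ 3 * (u + 3 * A) / (6 * u ^ 2) := by
    have : s = u ^ 2 - A ^ 2 := by linarith
    rw [this]
    field_simp
    ring
  have hnn : 0 ≤ (u - A) ^ 3 * (u + 3 * A) / (6 * u ^ 2) := by
    have : 0 ≤ u - A := by linarith
    positivity
  have e : 2 / 3 * (A ^ 3 + 3 * A * s + κ) / u
      = 2 / 3 * (A ^ 3 + 3 * A * s) / u + 2 / 3 * κ / u := by ring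
  linarith

/-- The logarithmic Sobolev inequality with twice the inverse spectral gap. -/
lemma satisfiesLSI (hn : 4 ≤ n) : SatisfiesLSI n (2 / (1 - Real.cos (2 * Real.pi / n))) := by
  rw [satisfiesLSI_iff (by omega)]
  intro f hf
  have hpos := one_sub_cos_pos hn
  have hn0 : (0 : ℝ) < n := Nat.cast_pos.mpr (NeZero.pos n)
  have hM : 0 ≤ (∑ x, f x ^ 2) / n := by positivity
  rcases hM.eq_or_lt with h0 | h0
  · have hz : ∑ x, f x ^ 2 = 0 := by
      rcases div_eq_zero_iff.mp h0.symm with h | h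
      · exact h
      · exact absurd h hn0.ne'
    have hz' : ∀ x, f x ^ 2 = 0 := fun x =>
      (sum_eq_zero_iff_of_nonneg fun x _ => sq_nonneg (f x)).mp hz x (mem_univ x)
    simp only [hz', zero_mul, sum_const_zero, zero_div, sub_zero]
    positivity
  set A := (∑ x, f x) / n with hAdef
  set g : ZMod n → ℝ := fun x => f x - A with hg
  have hfg : ∀ x, f x = A + g x := fun x => by simp [hg]
  have hg0 : ∑ x, g x = 0 := by
    simp only [hg, sum_sub_distrib, sum_const, card_univ, ZMod.card, nsmul_eq_mul, hAdef]
    field_simp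
    ring
  have hA : 0 ≤ A := div_nonneg (sum_nonneg fun x _ => hf x) hn0.le
  obtain ⟨m2, m3⟩ := mean_add_const g hg0 A
  simp only [← hfg] at m2 m3
  have hκ := sum_cube_sq_le hn g hg0
  have hdiff : ∀ x, g (x + 1) - g x = f (x + 1) - f x := fun x => by simp [hg]
  simp only [hdiff] at hκ
  have hu : 0 < √((∑ x, f x ^ 2) / n) := Real.sqrt_pos.mpr h0
  have hu2 : (∑ x, f x ^ 2) / n = √((∑ x, f x ^ 2) / n) ^ 2 := (Real.sq_sqrt hM).symm
  refine (entropy_le_moments f hf hu hu2).trans ?_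
  rw [m3]
  refine (moment_bound hA hu (by positivity) (by rw [add_sub_cancel]; positivity)
    (hu2.symm.trans m2) hκ).trans (le_of_eq ?_)
  ring

/-! ### Optimality of the constant -/

lemma re_stdAddChar_add_sub (hn : 2 ≤ n) (x : ZMod n) :
    (ZMod.stdAddChar (x + 1)).re + (ZMod.stdAddChar (x - 1)).re
      = 2 * Real.cos (2 * Real.pi / n) * (ZMod.stdAddChar x).re := by
  have h1 := re_stdAddChar (1 : ZMod n)
  rw [cycleLen_one hn] at h1
  have h2 : (2 : ℝ) * ((1 : ℕ) * (Real.pi / n)) = 2 * Real.pi / n := by push_cast; ring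
  rw [h2] at h1
  rw [sub_eq_add_neg, AddChar.map_add_eq_mul, AddChar.map_add_eq_mul, ← conj_stdAddChar, ← h1]
  simp only [Complex.mul_re, Complex.conj_re, Complex.conj_im]
  ring

/-- The real part of the standard character is an eigenfunction for the spectral gap. -/
lemma dirichlet_re_stdAddChar (hn : 3 ≤ n) :
    (∑ x : ZMod n, ((ZMod.stdAddChar (x + 1)).re - (ZMod.stdAddChar x).re) ^ 2) / (2 * n)
      = (1 - Real.cos (2 * Real.pi / n)) * ((∑ x : ZMod n, (ZMod.stdAddChar x).re ^ 2) / n) := by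
  have h := innerL2_one_sub_kernel hn fun x : ZMod n => (ZMod.stdAddChar x).re
  rw [← h, innerL2, integral_mu, ← mul_div_assoc, mul_sum]
  congr 1
  refine sum_congr rfl fun x _ => ?_
  rw [Matrix.sub_mulVec, Matrix.one_mulVec, Pi.sub_apply, kernel_mulVec hn,
    re_stdAddChar_add_sub (by omega)]
  ring

lemma abs_re_stdAddChar_le (x : ZMod n) : |(ZMod.stdAddChar x).re| ≤ 1 :=
  (Complex.abs_re_le_norm _).trans (by rw [ZMod.stdAddChar_apply, Circle.norm_coe])

lemma sum_re_stdAddChar (hn : 2 ≤ n) : ∑ x : ZMod n, (ZMod.stdAddChar x).re = 0 := by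
  have h := sum_stdAddChar_mul (1 : ZMod n)
  have h1 : (1 : ZMod n) ≠ 0 := fun h => by
    have := cycleLen_one hn
    rw [h, cycleLen_eq_zero.mpr rfl] at this
    omega
  rw [if_neg h1] at h
  simp only [one_mul] at h
  rw [← Complex.re_sum, h, Complex.zero_re]

/-- A lower bound for the entropy of small perturbations of the constant function. -/
lemma le_entropy_one_add (g : ZMod n → ℝ) (hg0 : ∑ x, g x = 0) (hg1 : ∀ x, |g x| ≤ 1) {ε : ℝ}
    (hε : 0 < ε) (hε2 : ε ≤ 1 / 2) :
    (2 - 21 * ε) * (ε ^ 2 * ((∑ x, g x ^ 2) / n)) ≤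
      (∑ x, (1 + ε * g x) ^ 2 * Real.log ((1 + ε * g x) ^ 2)) / n
        - (∑ x, (1 + ε * g x) ^ 2) / n * Real.log ((∑ x, (1 + ε * g x) ^ 2) / n) := by
  have hn0 : (0 : ℝ) < n := Nat.cast_pos.mpr (NeZero.pos n)
  have hs0 : 0 ≤ (∑ x, g x ^ 2) / n := by positivity
  have hs1 : (∑ x, g x ^ 2) / n ≤ 1 := by
    rw [div_le_one hn0]
    calc ∑ x, g x ^ 2 ≤ ∑ _x : ZMod n, (1 : ℝ) :=
          sum_le_sum fun x _ => (sq_le_one_iff_abs_le_one _).mpr (hg1 x)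
      _ = n := by simp [ZMod.card]
  have hm := (mean_add_const (fun x => ε * g x) (by rw [← mul_sum, hg0, mul_zero]) 1).1
  simp only [mul_pow, ← mul_sum, mul_div_assoc, one_pow] at hm
  have hp : ∀ x, 2 * ε * g x + (3 * ε ^ 2 - 20 * ε ^ 3) * g x ^ 2 ≤
      (1 + ε * g x) ^ 2 * Real.log ((1 + ε * g x) ^ 2) := by
    intro x
    have ha : |ε * g x| = ε * |g x| := by rw [abs_mul, abs_of_pos hε]
    refine le_trans ?_ (le_sq_mul_log_sq (y := ε * g x) ?_)
    · rw [ha]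
      have h1 : |g x| ^ 3 ≤ g x ^ 2 := by
        rw [← sq_abs (g x)]
        exact pow_le_pow_of_le_one (abs_nonneg _) (hg1 x) (by norm_num)
      have h2 := mul_le_mul_of_nonneg_left h1 (pow_nonneg hε.le 3)
      nlinarith
    · rw [ha]
      nlinarith [hg1 x, abs_nonneg (g x)]
  have hsum := div_le_div_of_nonneg_right
    (sum_le_sum fun x (_ : x ∈ (univ : Finset (ZMod n))) => hp x) hn0.le
  simp only [sum_add_distrib, ← mul_sum, hg0, mul_zero, zero_add, mul_div_assoc] at hsum
  rw [hm]
  have hlog := mul_log_one_add_le (mul_nonneg (sq_nonneg ε) hs0)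
  -- The quadratic error of the normalizing logarithm costs one more ε³s, turning 20 into 21.
  have h4 : (ε ^ 2 * ((∑ x, g x ^ 2) / n)) ^ 2 ≤ ε ^ 3 * ((∑ x, g x ^ 2) / n) := by
    set s := (∑ x, g x ^ 2) / n
    have h5 : ε * s ≤ 1 := by nlinarith
    have h6 : 0 ≤ ε ^ 3 * s := by positivity
    nlinarith
  nlinarith

lemma le_of_satisfiesLSI (hn : 4 ≤ n) {C : ℝ} (hC : SatisfiesLSI n C) :
    2 / (1 - Real.cos (2 * Real.pi / n)) ≤ C := by
  rw [satisfiesLSI_iff (by omega)] at hC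
  have hpos := one_sub_cos_pos hn
  have hn0 : (0 : ℝ) < n := Nat.cast_pos.mpr (NeZero.pos n)
  set c : ZMod n → ℝ := fun x => (ZMod.stdAddChar x).re with hc
  have hs : 0 < (∑ x, c x ^ 2) / n := by
    refine div_pos (lt_of_lt_of_le one_pos ?_) hn0
    have h1 : c 0 ^ 2 = 1 := by simp [hc]
    rw [← h1]
    exact single_le_sum (f := fun x => c x ^ 2) (fun x _ => sq_nonneg _) (mem_univ 0)
  have key : ∀ ε : ℝ, 0 < ε → ε ≤ 1 / 2 →
      2 - 21 * ε ≤ C * (1 - Real.cos (2 * Real.pi / n)) := by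
    intro ε hε hε2
    have hl := le_entropy_one_add c (sum_re_stdAddChar (by omega)) abs_re_stdAddChar_le hε hε2
    have hu := hC (fun x => 1 + ε * c x) fun x => by
      have := (abs_le.mp (abs_re_stdAddChar_le x)).1
      have : -1 ≤ c x := this
      nlinarith
    have hd : ∑ x, (1 + ε * c (x + 1) - (1 + ε * c x)) ^ 2
        = ε ^ 2 * ∑ x, (c (x + 1) - c x) ^ 2 := by
      rw [mul_sum]
      exact sum_congr rfl fun x _ => by ring
    rw [hd, mul_div_assoc, dirichlet_re_stdAddChar (by omega)] at hu
    have hq : 0 < ε ^ 2 * ((∑ x, c x ^ 2) / n) := by positivity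
    refine le_of_mul_le_mul_right (hl.trans (hu.trans (le_of_eq ?_))) hq
    ring
  rw [div_le_iff₀ hpos]
  by_contra! hlt
  -- With this ε, 21ε is at most half of the supposed positive gap 2 - Cλ.
  have := key (min (1 / 2) ((2 - C * (1 - Real.cos (2 * Real.pi / n))) / 42))
    (lt_min (by norm_num) (by linarith)) (min_le_left _ _)
  have h2 := min_le_right (1 / 2 : ℝ) ((2 - C * (1 - Real.cos (2 * Real.pi / n))) / 42)
  linarith

end Functionals

end CyclicWalk

theorem corollary1p4 (n : ℕ) [NeZero n] (hn : 4 ≤ n) :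
    IsLeast {C : ℝ | CyclicWalk.SatisfiesLSI n C} (2 / (1 - Real.cos (2 * Real.pi / n))) :=
  ⟨CyclicWalk.satisfiesLSI hn, fun _ hC => CyclicWalk.le_of_satisfiesLSI hn hC⟩
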